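/- Setting. Let $\mathbb X_n=\{x_1,\dots,x_n\}$ be a point cloud in a metric space $X$, let $r\in\mathbb N$, and fix a clustering algorithm $\mathrm{Clus}$, which partitions every finite subset of $X$ into nonempty clusters. For a binary matrix $e\in\{0,1\}^{n\times r}$, let $\mathrm{MapComp}(e)$ be the graph (simplicial complex of dimension at most $1$) whose vertices are the clusters of the sets $\{x_i : e_{i,j}=1\}$, $1\le j\le r$, two distinct clusters being joined by an edge if and only if they intersect. For $F\colon\mathbb X_n\to\mathbb R$, filter this graph by $\phi(\sigma)=\max_{c\in\sigma}\frac1{\mathrm{card}(c)}\sum_{x\in c}F(x)$, and let $\mathrm{MapPers}(\mathrm{MapComp}(e),F)$ be the extended persistence diagram (all degrees together) of the resulting filtered graph; it is an element of the set $PD$ of finite multisets of points of $\mathbb R^2\setminus\Delta$, where $\Delta=\{(t,t):t\in\mathbb R\}$. Let $\ell\colon PD\to\mathbb R$, and let $\{f_\theta\colon\mathbb X_n\to\mathbb R\}_{\theta\in\mathbb R^s}$ be a family of functions. Let $A$ be a random element of $\{0,1\}^{n\times r}$ whose conditional law given $\mathbb X_n$ is governed, for each $\theta\in\mathbb R^s$,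 by a probability $\mathbb P_\theta(\,\cdot\mid\mathbb X_n)$. The Soft Mapper topological risk is $$\mathrm L(\theta)=\mathbb E_\theta\big[\ell(\mathrm{MapPers}(\mathrm{MapComp}(A),f_\theta))\mid\mathbb X_n\big]=\sum_{e\in\{0,1\}^{n\times r}}\ell\big(\mathrm{MapPers}(\mathrm{MapComp}(e),f_\theta)\big)\cdot\mathbb P_\theta(A=e\mid\mathbb X_n),\qquad\theta\in\mathbb R^s.$$ Theorem. Suppose that there is an o-minimal structure $\mathcal S$ on the field of real numbers such that: 1. for every $x\in\mathbb X_n$, the function $\theta\mapsto f_\theta(x)$ is definable in $\mathcal S$ and locally Lipschitz; 2. for every $m\in\mathbb N$, the restriction of $\ell$ to persistence diagrams of size $m$ is definable in $\mathcal S$ and locally Lipschitz; that is, so is the function $(b_1,d_1,\dots,b_m,d_m)\mapsto\ell(\{(b_1,d_1),\dots,(b_m,d_m)\})$ on $\mathbb R^{2m}$, where a diagram of size $m$ is given by $m$ points of $\mathbb R^2$ counted with multiplicity, and those on $\Delta$ are allowed but immaterial (they are discarded before $\ell$ is evaluated); 3. for every $e\in\{0,1\}^{n\times r}$, the function $\theta\mapsto\mathbb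 P_\theta(A=e\mid\mathbb X_n)$ is definable in $\mathcal S$ and locally Lipschitz. Then $\mathrm L\colon\mathbb R^s\to\mathbb R$ is definable in $\mathcal S$ and locally Lipschitz. -/

import Mathlib

open MeasureTheory

noncomputable section

/-! ### o-minimal structures on the real field -/

/-- An o-minimal structure on the field of real numbers: a family `sets n` of sets of subsets of
`ℝ^n` (the definable sets). -/
structure OMinimalStructure where
  /-- the definable subsets of `ℝ^n` -/
  sets : (n : ℕ) → Set (Set (Fin n → ℝ))
  /-- algebraic subsets are definable -/
  algebraic_mem : ∀ (n : ℕ) (P : Set (MvPolynomial (Fin n) ℝ)),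
    {v : Fin n → ℝ | ∀ p ∈ P, MvPolynomial.eval v p = 0} ∈ sets n
  union_mem : ∀ (n : ℕ) (A B : Set (Fin n → ℝ)), A ∈ sets n → B ∈ sets n → A ∪ B ∈ sets n
  inter_mem : ∀ (n : ℕ) (A B : Set (Fin n → ℝ)), A ∈ sets n → B ∈ sets n → A ∩ B ∈ sets n
  compl_mem : ∀ (n : ℕ) (A : Set (Fin n → ℝ)), A ∈ sets n → Aᶜ ∈ sets n
  /-- Cartesian products of definable sets are definable -/
  prod_mem : ∀ (n m : ℕ) (A : Set (Fin n → ℝ)) (B : Set (Fin m → ℝ)), A ∈ sets n → B ∈ sets m →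
    {v : Fin (n + m) → ℝ | (fun i => v (Fin.castAdd m i)) ∈ A ∧ (fun j => v (Fin.natAdd n j)) ∈ B}
      ∈ sets (n + m)
  /-- projections onto the first `n` coordinates of definable sets are definable -/
  proj_mem : ∀ (n : ℕ) (A : Set (Fin (n + 1) → ℝ)), A ∈ sets (n + 1) →
    (fun (v : Fin (n + 1) → ℝ) (i : Fin n) => v i.castSucc) '' A ∈ sets n
  /-- the definable subsets of `ℝ` are exactly the finite unions of points and intervals
  (order-connected subsets of `ℝ`, bounded or not) -/
  mem_one_iff : ∀ A : Set (Fin 1 → ℝ), A ∈ sets 1 ↔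
    ∃ I : Set (Set ℝ), I.Finite ∧ (∀ J ∈ I, J.OrdConnected) ∧ {t : ℝ | (fun _ => t) ∈ A} = ⋃₀ I

/-- A map `ℝ^n → ℝ^m` is definable if its graph is a definable subset of `ℝ^(n+m)`. -/
def OMinimalStructure.DefinableMap (S : OMinimalStructure) {n m : ℕ}
    (g : (Fin n → ℝ) → (Fin m → ℝ)) : Prop :=
  {v : Fin (n + m) → ℝ |
    (fun j => v (Fin.natAdd n j)) = g (fun i => v (Fin.castAdd m i))} ∈ S.sets (n + m)

/-- A real-valued function on `ℝ^n` is definable if it is definable as a map to `ℝ^1`. -/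
def OMinimalStructure.DefinableFun (S : OMinimalStructure) {n : ℕ} (g : (Fin n → ℝ) → ℝ) : Prop :=
  S.DefinableMap (fun v (_ : Fin 1) => g v)

/-! ### Mapper complexes -/

/-- A clustering algorithm on `X`: to every finite set of points it associates a partition of this
set into (nonempty) clusters. -/
abbrev ClusteringAlgorithm (X : Type*) [DecidableEq X] : Type _ :=
  (s : Finset X) → Finpartition s

/-- `r`-latent cover assignments of a cloud of `n` points: binary `n × r` matrices. -/
abbrev CoverAssignment (n r : ℕ) : Type := Fin n → Fin r → Bool

/-- Finite simplicial complexes of dimension at most `1`, with vertices in `V`. -/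
structure GraphComplex (V : Type*) extends PreAbstractSimplicialComplex V where
  finite_faces : faces.Finite
  card_le_two : ∀ σ ∈ faces, σ.card ≤ 2

section Mapper

variable {X : Type*} [DecidableEq X] {n r : ℕ}

/-- The `j`-th element of the latent cover, `{x_i : e_{i,j} = 1}`. -/
def latentCover (x : Fin n → X) (e : CoverAssignment n r) (j : Fin r) : Finset X :=
  (Finset.univ.filter (fun i => e i j = true)).image x

/-- The pullback cover: all the clusters of all the elements of the latent cover. -/
def pullbackCover (Clus : ClusteringAlgorithm X) (x : Fin n → X) (e : CoverAssignment n r) :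
    Finset (Finset X) :=
  Finset.univ.biUnion (fun j => (Clus (latentCover x e j)).parts)

/-- The Mapper complex of a latent cover assignment: the vertices are the elements of the pullback
cover, and two of them are joined by an edge if and only if they intersect. -/
def mapComp (Clus : ClusteringAlgorithm X) (x : Fin n → X) (e : CoverAssignment n r) :
    GraphComplex (Finset X) where
  faces := {σ | σ.Nonempty ∧ σ ⊆ pullbackCover Clus x e ∧ σ.card ≤ 2 ∧
    ∀ c ∈ σ, ∀ c' ∈ σ, c ≠ c' → (c ∩ c').Nonempty}
  isRelLowerSet_faces := by
    rintro σ ⟨h1, h2, h3, h4⟩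
    refine ⟨h1, fun τ hτ hne => ⟨hne, subset_trans hτ h2, (Finset.card_le_card hτ).trans h3, ?_⟩⟩
    exact fun c hc c' hc' => h4 c (hτ hc) c' (hτ hc')
  finite_faces :=
    (pullbackCover Clus x e).powerset.finite_toSet.subset
      (fun _ h => Finset.mem_coe.2 (Finset.mem_powerset.2 h.2.1))
  card_le_two := fun _ h => h.2.2.1

end Mapper

/-- The average value of `F` on a finite set `c` of points. -/
def clusterMean {X : Type*} (F : X → ℝ) (c : Finset X) : ℝ := (∑ y ∈ c, F y) / (c.card : ℝ)

/-- The filtration `φ(σ) = max_{c ∈ σ} (average of F on c)`; a simplex `σ` is finite and nonempty,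
so that the supremum is a maximum. -/
def mapperFiltration {X : Type*} (F : X → ℝ) (σ : Finset (Finset X)) : ℝ :=
  sSup (clusterMean F '' (σ : Set (Finset X)))

/-! ### Persistence diagrams -/

/-- Persistence diagrams: finite multisets of points of the plane outside the diagonal. -/
def PersDiagram : Type := {D : Multiset (ℝ × ℝ) // ∀ p ∈ D, p.1 ≠ p.2}

/-- The persistence diagram of a finite multiset of points of the plane, in which the points on the
diagonal are immaterial and hence discarded. -/
def PersDiagram.ofMultiset (M : Multiset (ℝ × ℝ)) : PersDiagram :=
  ⟨M.filter (fun p => p.1 ≠ p.2), fun _ hp => (Multiset.mem_filter.1 hp).2⟩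

/-- The persistence diagram of size `m` with coordinates `v = (b_1, d_1, …, b_m, d_m) ∈ ℝ^(2m)`,
i.e. with the points `(b_1, d_1), …, (b_m, d_m)`. -/
def PersDiagram.ofCoords (m : ℕ) (v : Fin (m * 2) → ℝ) : PersDiagram :=
  PersDiagram.ofMultiset ((Finset.univ : Finset (Fin m)).val.map
    (fun i => (v (finProdFinEquiv (i, 0)), v (finProdFinEquiv (i, 1)))))

/-! ### Extended persistent homology, with coefficients in `ℤ/2` -/

section ExtendedPersistence

variable {V : Type*} [DecidableEq V]

/-- The simplicial boundary operator with coefficients in `ℤ/2` (unreduced: the boundary of a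
vertex is zero). -/
def simplicialBoundary : (Finset V →₀ ZMod 2) →ₗ[ZMod 2] (Finset V →₀ ZMod 2) :=
  Finsupp.linearCombination (ZMod 2)
    (fun σ : Finset V => if σ.card ≤ 1 then 0 else ∑ v ∈ σ, Finsupp.single (σ.erase v) 1)

/-- The `p`-chains of a set `K` of simplices. -/
def simplicialChains (p : ℕ) (K : Set (Finset V)) : Submodule (ZMod 2) (Finset V →₀ ZMod 2) :=
  Finsupp.supported (ZMod 2) (ZMod 2) {σ | σ ∈ K ∧ σ.card = p + 1}

/-- The relative `p`-cycles of a pair `P = (K, L)` of complexes with `L ⊆ K`: the `p`-chains of `K`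
whose boundary lies in `L`. -/
def relativeCycles (p : ℕ) (P : Set (Finset V) × Set (Finset V)) :
    Submodule (ZMod 2) (Finset V →₀ ZMod 2) :=
  simplicialChains p P.1 ⊓ (Finsupp.supported (ZMod 2) (ZMod 2) P.2).comap simplicialBoundary

/-- The relative `p`-boundaries of a pair `P = (K, L)`: the sums of a boundary of a `(p+1)`-chain
of `K` and of a `p`-chain of `L`. Thus `H_p(K, L)` is `relativeCycles p P` modulo
`relativeBoundaries p P`. -/
def relativeBoundaries (p : ℕ) (P : Set (Finset V) × Set (Finset V)) :
    Submodule (ZMod 2) (Finset V →₀ ZMod 2) :=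
  (simplicialChains (p + 1) P.1).map simplicialBoundary ⊔ simplicialChains p P.2

/-- The persistent Betti number: for pairs `P = (K, L)` and `Q = (K', L')` with `K ⊆ K'` and
`L ⊆ L'`, the rank of the map `H_p(K, L) → H_p(K', L')` induced by the inclusion. Its image is the
image of the cycles of `P` in the quotient by the boundaries of `Q`. -/
def persistentBetti (p : ℕ) (P Q : Set (Finset V) × Set (Finset V)) : ℕ :=
  Module.finrank (ZMod 2) ((relativeCycles p P).map (relativeBoundaries p Q).mkQ)

/-- The number of classes of degree `p` which are born at stage `P` and die at stage `Q`, where `P'`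
and `Q'` are the stages of the filtration that come immediately before `P` and `Q`, and `P` is
strictly before `Q`. The difference is never negative. -/
def persistenceMultiplicity (p : ℕ) (P' P Q' Q : Set (Finset V) × Set (Finset V)) : ℕ :=
  (persistentBetti p P Q' + persistentBetti p P' Q) -
    (persistentBetti p P Q + persistentBetti p P' Q')

namespace GraphComplex

variable (K : GraphComplex V) (φ : Finset V → ℝ)

/-- The ascending stage `(K_{≤ a}, ∅)`, with `K_{≤ a}` the sublevel complex at level `a`. -/
def ascStage (a : ℝ) : Set (Finset V) × Set (Finset V) := ({σ | σ ∈ K.faces ∧ φ σ ≤ a}, ∅)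

/-- The stage immediately before `(K_{≤ a}, ∅)`, namely `(K_{< a}, ∅)`. -/
def ascStageBefore (a : ℝ) : Set (Finset V) × Set (Finset V) := ({σ | σ ∈ K.faces ∧ φ σ < a}, ∅)

/-- The descending stage `(K, K^{≥ a})`, with `K^{≥ a}` the full subcomplex of `K` spanned by the
vertices of filtration value at least `a`. -/
def descStage (a : ℝ) : Set (Finset V) × Set (Finset V) :=
  (K.faces, {σ | σ ∈ K.faces ∧ ∀ v ∈ σ, a ≤ φ {v}})

/-- The stage immediately before `(K, K^{≥ a})`, namely `(K, K^{> a})`. -/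
def descStageBefore (a : ℝ) : Set (Finset V) × Set (Finset V) :=
  (K.faces, {σ | σ ∈ K.faces ∧ ∀ v ∈ σ, a < φ {v}})

/-- The finitely many values of the filtration. -/
def filtrationValues : Finset ℝ := K.finite_faces.toFinset.image φ

/-- The extended persistence diagram of the filtered complex `(K, φ)`, in all degrees: the classes
which are born and die in the extended filtration
`∅ → K_{≤ a_1} → … → K_{≤ a_k} = K = (K, ∅) → (K, K^{≥ a_k}) → … → (K, K^{≥ a_1})`,
where `a_1 < … < a_k` are the values of `φ`, each giving the point (value of its birth stage, value
of its death stage). The three families below are the ordinary points (born and dead in the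
ascending part), the extended points (born in the ascending part, dead in the descending part) and
the relative points (born and dead in the descending part). -/
def extendedDiagram : PersDiagram :=
  PersDiagram.ofMultiset
    (∑ p ∈ Finset.range 2, ∑ a ∈ K.filtrationValues φ, ∑ b ∈ K.filtrationValues φ,
      ((if a < b then
          Multiset.replicate (persistenceMultiplicity p (K.ascStageBefore φ a) (K.ascStage φ a)
            (K.ascStageBefore φ b) (K.ascStage φ b)) (a, b)
        else 0) +
        Multiset.replicate (persistenceMultiplicity p (K.ascStageBefore φ a) (K.ascStage φ a)
          (K.descStageBefore φ b) (K.descStage φ b)) (a, b) +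
        (if b < a then
          Multiset.replicate (persistenceMultiplicity p (K.descStageBefore φ a) (K.descStage φ a)
            (K.descStageBefore φ b) (K.descStage φ b)) (a, b)
        else 0)))

end GraphComplex

end ExtendedPersistence

/-! ### The topological risk of Soft Mapper -/

section Risk

variable {X : Type*} [DecidableEq X] {n r : ℕ}

/-- The extended persistence diagram of a complex whose vertices are finite sets of points, for the
filtration induced by a function `F` on the points. -/
def mapPers (K : GraphComplex (Finset X)) (F : X → ℝ) : PersDiagram :=
  K.extendedDiagram (mapperFiltration F)

/-- The loss of the Mapper complex of the cover assignment `e`, filtered by `F`. -/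
def mapperLoss (Clus : ClusteringAlgorithm X) (x : Fin n → X) (ℓ : PersDiagram → ℝ)
    (e : CoverAssignment n r) (F : X → ℝ) : ℝ :=
  ℓ (mapPers (mapComp Clus x e) F)

/-- The topological risk `L(θ) = E_θ[𝓛(A, f_θ)]` of the Soft Mapper of the cover assignment scheme
`A`, whose distribution under `Pr θ` depends on the parameter `θ`. -/
def softMapperRisk {Θ Ω : Type*} [MeasurableSpace Ω] (Clus : ClusteringAlgorithm X)
    (x : Fin n → X) (ℓ : PersDiagram → ℝ) (f : Θ → X → ℝ) (Pr : Θ → Measure Ω)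
    (A : Ω → CoverAssignment n r) (θ : Θ) : ℝ :=
  ∫ ω, mapperLoss Clus x ℓ (A ω) (f θ) ∂(Pr θ)

/-- The risk as a finite sum over all the cover assignments. -/
theorem softMapperRisk_eq_sum {Θ Ω : Type*} [MeasurableSpace Ω] (Clus : ClusteringAlgorithm X)
    (x : Fin n → X) (ℓ : PersDiagram → ℝ) (f : Θ → X → ℝ) (Pr : Θ → Measure Ω)
    [∀ θ, IsProbabilityMeasure (Pr θ)] (A : Ω → CoverAssignment n r) (hA : Measurable A) (θ : Θ) :
    softMapperRisk Clus x ℓ f Pr A θ =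
      ∑ e : CoverAssignment n r, mapperLoss Clus x ℓ e (f θ) * (Pr θ).real {ω | A ω = e} := by
  unfold softMapperRisk
  have : IsProbabilityMeasure ((Pr θ).map A) := Measure.isProbabilityMeasure_map hA.aemeasurable
  rw [← integral_map (f := fun e => mapperLoss Clus x ℓ e (f θ)) hA.aemeasurable
    (measurable_of_finite _).aestronglyMeasurable, integral_fintype .of_finite]
  refine Finset.sum_congr rfl fun e _ => ?_
  rw [smul_eq_mul, mul_comm, map_measureReal_apply hA (measurableSet_singleton e)]
  rfl

end Risk

end

/-! The risk is a finite sum over cover assignments of losses times probabilities, so it suffices to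
treat the loss of one fixed Mapper graph. There the filtration is determined by the cluster means,
which are fixed linear combinations of the values of `f θ` on the cloud.

For each ordering `π` of the clusters, the parameters whose means are nondecreasing along `π` form a
closed definable set, and these finitely many sets cover the space. On each of them the diagram is
obtained from a fixed list of pairs of clusters by reading off their means
(`extendedDiagram_eq_map_enumPairs`): refine the extended filtration so that one vertex enters at a
time, and note that persistence multiplicities, being mixed second differences of ranks, add up over
blocks of steps. Ties between means change only the diagonal points, which are discarded.

So on each piece the loss is `ℓ` in coordinates of a fixed size, composed with cluster means. The
pieces are glued by `definableFun_of_cover` and `locallyLipschitz_of_closed_cover`; the latter needs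
the pieces closed and the formula on each piece to extend to the whole space. -/

noncomputable section

/-! ### Calculus of definable sets and functions -/

namespace OMinimalStructure

variable (S : OMinimalStructure)

theorem univ_mem (n : ℕ) : (Set.univ : Set (Fin n → ℝ)) ∈ S.sets n := by
  simpa using S.algebraic_mem n ∅

theorem zeroLocus_mem {n : ℕ} (p : MvPolynomial (Fin n) ℝ) :
    {v : Fin n → ℝ | MvPolynomial.eval v p = 0} ∈ S.sets n := by
  simpa using S.algebraic_mem n {p}

theorem iInter_mem {n : ℕ} {ι : Type*} [Finite ι] (A : ι → Set (Fin n → ℝ))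
    (hA : ∀ i, A i ∈ S.sets n) : ⋂ i, A i ∈ S.sets n := by
  classical
  have := Fintype.ofFinite ι
  suffices h : ∀ I : Finset ι, ⋂ i ∈ I, A i ∈ S.sets n by simpa using h Finset.univ
  intro I
  induction I using Finset.induction_on with
  | empty => simpa using S.univ_mem n
  | insert a I _ ih =>
    rw [Finset.set_biInter_insert]
    exact S.inter_mem n _ _ (hA a) ih

theorem iUnion_mem {n : ℕ} {ι : Type*} [Finite ι] (A : ι → Set (Fin n → ℝ))
    (hA : ∀ i, A i ∈ S.sets n) : ⋃ i, A i ∈ S.sets n := by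
  have h := S.compl_mem n _ (S.iInter_mem (fun i => (A i)ᶜ) fun i => S.compl_mem n _ (hA i))
  simpa [Set.compl_iInter] using h

/-- Projections forgetting any number of trailing coordinates preserve definability. -/
theorem image_castAdd_mem (n m : ℕ) (A : Set (Fin (n + m) → ℝ)) (hA : A ∈ S.sets (n + m)) :
    (fun (v : Fin (n + m) → ℝ) (i : Fin n) => v (Fin.castAdd m i)) '' A ∈ S.sets n := by
  induction m with
  | zero =>
    have : (fun (v : Fin (n + 0) → ℝ) (i : Fin n) => v (Fin.castAdd 0 i)) '' A = A :=
      Set.image_id A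
    rw [this]
    exact hA
  | succ m ih =>
    have h := ih _ (S.proj_mem (n + m) A hA)
    rw [Set.image_image] at h
    exact h

/-- Substituting coordinates (with repetitions and dummies allowed) preserves definability. -/
theorem comap_mem {n m : ℕ} (σ : Fin m → Fin n) {A : Set (Fin m → ℝ)} (hA : A ∈ S.sets m) :
    {v : Fin n → ℝ | (fun i => v (σ i)) ∈ A} ∈ S.sets n := by
  -- The set is the projection to `v` of the pairs `(v, w)` with `w ∈ A` and `w i = v (σ i)` for all
  -- `i`.
  have h1 := S.prod_mem n m _ A (S.univ_mem n) hA
  have h2 := S.iInter_mem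
    (fun i : Fin m => {v : Fin (n + m) → ℝ | v (Fin.natAdd n i) = v (Fin.castAdd m (σ i))})
    (fun i => by
      have h := S.zeroLocus_mem
        (MvPolynomial.X (Fin.natAdd n i) - MvPolynomial.X (Fin.castAdd m (σ i)))
      simpa only [map_sub, MvPolynomial.eval_X, sub_eq_zero] using h)
  convert S.image_castAdd_mem n m _ (S.inter_mem _ _ _ h1 h2) using 1
  ext v
  constructor
  · intro hv
    exact ⟨Fin.append v (fun i => v (σ i)), by simpa using hv, by simp⟩
  · rintro ⟨w, ⟨⟨-, hw⟩, hw'⟩, rfl⟩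
    simp only [Set.mem_iInter, Set.mem_ofPred_eq] at hw'
    simpa [← hw'] using hw

theorem definableFun_iff {n : ℕ} {g : (Fin n → ℝ) → ℝ} :
    S.DefinableFun g ↔
      {v : Fin (n + 1) → ℝ | v (Fin.natAdd n 0) = g (fun i => v (Fin.castAdd 1 i))} ∈
        S.sets (n + 1) := by
  unfold DefinableFun DefinableMap
  simp [funext_iff]

theorem setOf_eq_comp_mem {n k : ℕ} {g : (Fin n → ℝ) → ℝ} (hg : S.DefinableFun g)
    (σ : Fin n → Fin k) (j : Fin k) :
    {v : Fin k → ℝ | v j = g (fun i => v (σ i))} ∈ S.sets k := by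
  have h := S.comap_mem (Fin.append σ (fun _ : Fin 1 => j)) (S.definableFun_iff.1 hg)
  simpa using h

/-- Preimages of definable sets under maps with definable components are definable. -/
theorem preimage_mem {n m : ℕ} {f : Fin m → (Fin n → ℝ) → ℝ} (hf : ∀ i, S.DefinableFun (f i))
    {B : Set (Fin m → ℝ)} (hB : B ∈ S.sets m) :
    {v : Fin n → ℝ | (fun i => f i v) ∈ B} ∈ S.sets n := by
  have h1 := S.prod_mem n m _ B (S.univ_mem n) hB
  have h2 := S.iInter_mem _
    (fun i : Fin m => S.setOf_eq_comp_mem (hf i) (Fin.castAdd m) (Fin.natAdd n i))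
  convert S.image_castAdd_mem n m _ (S.inter_mem _ _ _ h1 h2) using 1
  ext v
  constructor
  · intro hv
    exact ⟨Fin.append v (fun i => f i v), by simpa using hv, by simp⟩
  · rintro ⟨w, ⟨⟨-, hw⟩, hw'⟩, rfl⟩
    simp only [Set.mem_iInter, Set.mem_ofPred_eq] at hw'
    simpa [← hw'] using hw

variable {S}

theorem DefinableFun.comp_coords {n k : ℕ} {g : (Fin n → ℝ) → ℝ} (hg : S.DefinableFun g)
    (σ : Fin n → Fin k) : S.DefinableFun (fun v : Fin k → ℝ => g (fun i => v (σ i))) :=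
  S.definableFun_iff.2 (S.setOf_eq_comp_mem hg (fun i => Fin.castAdd 1 (σ i)) (Fin.natAdd k 0))

theorem definableFun_eval {n : ℕ} (p : MvPolynomial (Fin n) ℝ) :
    S.DefinableFun (fun v => MvPolynomial.eval v p) := by
  rw [definableFun_iff]
  have h := S.zeroLocus_mem
    (MvPolynomial.X (Fin.natAdd n 0) - MvPolynomial.rename (Fin.castAdd 1) p)
  simpa [sub_eq_zero, MvPolynomial.eval_rename, Function.comp_def] using h

theorem definableFun_const {n : ℕ} (c : ℝ) : S.DefinableFun (fun _ : Fin n → ℝ => c) := by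
  simpa using definableFun_eval (S := S) (MvPolynomial.C c : MvPolynomial (Fin n) ℝ)

theorem definableFun_apply {n : ℕ} (i : Fin n) : S.DefinableFun (fun v : Fin n → ℝ => v i) := by
  simpa using definableFun_eval (S := S) (MvPolynomial.X i : MvPolynomial (Fin n) ℝ)

theorem DefinableFun.comp {n m : ℕ} {g : (Fin m → ℝ) → ℝ} (hg : S.DefinableFun g)
    {f : Fin m → (Fin n → ℝ) → ℝ} (hf : ∀ i, S.DefinableFun (f i)) :
    S.DefinableFun (fun v => g (fun i => f i v)) := by
  rw [definableFun_iff] at hg ⊢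
  -- The graph of the composite is the preimage of the graph of `g` under `(v, y) ↦ (f v, y)`.
  have h := S.preimage_mem (n := n + 1) (f := Fin.append
      (fun i v => f i (fun j => v (Fin.castAdd 1 j))) (fun _ v => v (Fin.natAdd n 0)))
    (Fin.addCases (fun i => by simpa using (hf i).comp_coords (Fin.castAdd 1))
      (fun i => by simpa using definableFun_apply _)) hg
  simpa using h

theorem DefinableFun.add {n : ℕ} {f g : (Fin n → ℝ) → ℝ} (hf : S.DefinableFun f)
    (hg : S.DefinableFun g) : S.DefinableFun (fun v => f v + g v) := by
  have h := (definableFun_eval (S := S) (MvPolynomial.X (0 : Fin 2) + MvPolynomial.X 1)).comp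
    (f := ![f, g]) (by simp [Fin.forall_fin_two, hf, hg])
  simpa using h

theorem DefinableFun.mul {n : ℕ} {f g : (Fin n → ℝ) → ℝ} (hf : S.DefinableFun f)
    (hg : S.DefinableFun g) : S.DefinableFun (fun v => f v * g v) := by
  have h := (definableFun_eval (S := S) (MvPolynomial.X (0 : Fin 2) * MvPolynomial.X 1)).comp
    (f := ![f, g]) (by simp [Fin.forall_fin_two, hf, hg])
  simpa using h

theorem DefinableFun.sum {n : ℕ} {ι : Type*} {f : ι → (Fin n → ℝ) → ℝ} (I : Finset ι)
    (hf : ∀ i ∈ I, S.DefinableFun (f i)) : S.DefinableFun (fun v => ∑ i ∈ I, f i v) := by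
  classical
  induction I using Finset.induction_on with
  | empty => simpa using definableFun_const 0
  | insert a I ha ih =>
    simp only [Finset.sum_insert ha]
    exact (hf a (by simp)).add (ih fun i hi => hf i (by simp [hi]))

theorem DefinableFun.setOf_le_mem {n : ℕ} {f g : (Fin n → ℝ) → ℝ} (hf : S.DefinableFun f)
    (hg : S.DefinableFun g) : {v | f v ≤ g v} ∈ S.sets n := by
  -- The order enters definability only here: the half-line is definable as an interval, and the set
  -- is its preimage under `g - f`.
  have hB : {w : Fin 1 → ℝ | 0 ≤ w 0} ∈ S.sets 1 :=
    (S.mem_one_iff _).2 ⟨{Set.Ici 0}, Set.finite_singleton _, by simp [Set.ordConnected_Ici],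
      by simp [Set.Ici]⟩
  have h := S.preimage_mem (f := fun _ => _)
    (fun _ => hg.add ((definableFun_const (-1)).mul hf)) hB
  simpa using h

/-- A function that agrees with finitely many definable functions on definable pieces covering the
whole space is definable. -/
theorem definableFun_of_cover {n : ℕ} {ι : Type*} [Finite ι] {g : (Fin n → ℝ) → ℝ}
    {E : ι → Set (Fin n → ℝ)} {G : ι → (Fin n → ℝ) → ℝ} (hE : ∀ i, E i ∈ S.sets n)
    (hG : ∀ i, S.DefinableFun (G i)) (hcov : ∀ v, ∃ i, v ∈ E i)
    (heq : ∀ i, ∀ v ∈ E i, g v = G i v) : S.DefinableFun g := by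
  rw [definableFun_iff]
  -- The graph of `g` is the union of the graphs of the `G i` restricted to the `E i`.
  convert S.iUnion_mem _ (fun i => S.inter_mem _ _ _ (S.comap_mem (Fin.castAdd 1) (hE i))
    (S.definableFun_iff.1 (hG i))) using 1
  ext v
  simp only [Set.mem_ofPred_eq, Set.mem_iUnion, Set.mem_inter_iff]
  constructor
  · intro hv
    obtain ⟨i, hi⟩ := hcov (fun i => v (Fin.castAdd 1 i))
    exact ⟨i, hi, hv.trans (heq i _ hi)⟩
  · rintro ⟨i, hi, hv⟩
    exact hv.trans (heq i _ hi).symm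

end OMinimalStructure

/-! ### Locally Lipschitz functions and gluing along closed covers -/

section LocallyLipschitz

open scoped NNReal Topology

theorem LocallyLipschitz.pi {α ι : Type*} [PseudoEMetricSpace α] [Fintype ι] {E : ι → Type*}
    [∀ i, PseudoEMetricSpace (E i)] {f : ∀ i, α → E i} (hf : ∀ i, LocallyLipschitz (f i)) :
    LocallyLipschitz (fun a i => f i a) := by
  intro a
  choose K t ht hK using fun i => hf i a
  refine ⟨∑ i, K i, ⋂ i, t i, Filter.iInter_mem.2 ht, fun y hy z hz => ?_⟩
  rw [Set.mem_iInter] at hy hz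
  refine edist_pi_le_iff.2 fun i => (hK i (hy i) (hz i)).trans ?_
  gcongr
  exact Finset.single_le_sum (f := K) (fun _ _ => zero_le) (Finset.mem_univ i)

theorem LocallyLipschitz.add_real {α : Type*} [PseudoEMetricSpace α] {f g : α → ℝ}
    (hf : LocallyLipschitz f) (hg : LocallyLipschitz g) : LocallyLipschitz (fun a => f a + g a) :=
  (contDiff_fst.add contDiff_snd : ContDiff ℝ 1 fun p : ℝ × ℝ => p.1 + p.2).locallyLipschitz.comp
    (hf.prodMk hg)

theorem LocallyLipschitz.mul_real {α : Type*} [PseudoEMetricSpace α] {f g : α → ℝ}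
    (hf : LocallyLipschitz f) (hg : LocallyLipschitz g) : LocallyLipschitz (fun a => f a * g a) :=
  (contDiff_fst.mul contDiff_snd : ContDiff ℝ 1 fun p : ℝ × ℝ => p.1 * p.2).locallyLipschitz.comp
    (hf.prodMk hg)

theorem LocallyLipschitz.sum_real {α ι : Type*} [PseudoEMetricSpace α] {f : ι → α → ℝ}
    (I : Finset ι) (hf : ∀ i ∈ I, LocallyLipschitz (f i)) :
    LocallyLipschitz (fun a => ∑ i ∈ I, f i a) := by
  classical
  induction I using Finset.induction_on with
  | empty => simpa using LocallyLipschitz.const 0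
  | insert a I ha ih =>
    simp only [Finset.sum_insert ha]
    exact (hf a (by simp)).add_real (ih fun i hi => hf i (by simp [hi]))

/-- A function on an interval which is Lipschitz on each of finitely many closed sets covering the
interval satisfies the Lipschitz estimate between the endpoints. -/
theorem dist_le_of_closed_cover {ι Y : Type*} [PseudoMetricSpace Y] {h : ℝ → Y} {C : ℝ}
    {E : ι → Set ℝ} (hE : ∀ i, IsClosed (E i)) {b : ℝ} (I : Finset ι) :
    ∀ a ≤ b, (∀ i ∈ I, ∀ t ∈ E i ∩ Set.Icc a b, ∀ t' ∈ E i ∩ Set.Icc a b,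
        dist (h t) (h t') ≤ C * |t - t'|) →
      Set.Icc a b ⊆ ⋃ i ∈ I, E i → dist (h a) (h b) ≤ C * (b - a) := by
  classical
  induction I using Finset.strongInduction with
  | H I ih =>
    intro a hab hL hcov
    obtain ⟨i, hiI, hai⟩ := Set.mem_iUnion₂.1 (hcov (Set.left_mem_Icc.2 hab))
    have hcpt : IsCompact (E i ∩ Set.Icc a b) := isCompact_Icc.inter_left (hE i)
    -- Take the last point `t` of the piece containing `a`. The piece is never met again after `t`,
    -- so the other pieces cover the rest of the interval, and there is one fewer of them.
    obtain ⟨t, ht, hmax⟩ := hcpt.exists_isGreatest ⟨a, hai, Set.left_mem_Icc.2 hab⟩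
    have h1 := hL i hiI a ⟨hai, Set.left_mem_Icc.2 hab⟩ t ht
    rw [abs_sub_comm, abs_of_nonneg (sub_nonneg.2 ht.2.1)] at h1
    rcases ht.2.2.eq_or_lt with rfl | htb
    · exact h1
    have hcl : IsClosed (⋃ j ∈ I.erase i, E j) :=
      Set.Finite.isClosed_biUnion (I.erase i).finite_toSet fun j _ => hE j
    have hsub : Set.Ioc t b ⊆ ⋃ j ∈ I.erase i, E j := by
      intro y hy
      have hy' : y ∈ Set.Icc a b := ⟨ht.2.1.trans hy.1.le, hy.2⟩
      obtain ⟨j, hjI, hyj⟩ := Set.mem_iUnion₂.1 (hcov hy')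
      refine Set.mem_iUnion₂.2 ⟨j, Finset.mem_erase.2 ⟨?_, hjI⟩, hyj⟩
      rintro rfl
      exact absurd (hmax ⟨hyj, hy'⟩) (not_le.2 hy.1)
    -- The point `t` itself is recovered by closedness.
    have hsub' : Set.Icc t b ⊆ ⋃ j ∈ I.erase i, E j := by
      rw [← closure_Ioc htb.ne]
      exact hcl.closure_subset_iff.2 hsub
    have hmono : Set.Icc t b ⊆ Set.Icc a b := Set.Icc_subset_Icc_left ht.2.1
    have h2 := ih (I.erase i) (Finset.erase_ssubset hiI) t htb.le
      (fun j hj y hy z hz => hL j (Finset.mem_of_mem_erase hj) y ⟨hy.1, hmono hy.2⟩ z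
        ⟨hz.1, hmono hz.2⟩) hsub'
    calc dist (h a) (h b) ≤ dist (h a) (h t) + dist (h t) (h b) := dist_triangle _ _ _
      _ ≤ C * (t - a) + C * (b - t) := add_le_add h1 h2
      _ = C * (b - a) := by ring

/-- A function that agrees with finitely many locally Lipschitz functions on closed pieces covering
the whole space is locally Lipschitz. -/
theorem locallyLipschitz_of_closed_cover {V Y ι : Type*} [NormedAddCommGroup V] [NormedSpace ℝ V]
    [PseudoMetricSpace Y] [Finite ι] {g : V → Y} {E : ι → Set V} {G : ι → V → Y}
    (hE : ∀ i, IsClosed (E i)) (hG : ∀ i, LocallyLipschitz (G i)) (hcov : ∀ v, ∃ i, v ∈ E i)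
    (heq : ∀ i, ∀ v ∈ E i, g v = G i v) : LocallyLipschitz g := by
  have := Fintype.ofFinite ι
  intro x
  choose K t ht hK using fun i => hG i x
  obtain ⟨r, hr, hball⟩ := Metric.mem_nhds_iff.1 (Filter.iInter_mem.2 ht)
  refine ⟨∑ i, K i, Metric.ball x r, Metric.ball_mem_nhds x hr,
    LipschitzOnWith.of_dist_le_mul fun y hy z hz => ?_⟩
  -- Balls are convex, so the whole segment from `y` to `z` stays where every `G i` is Lipschitz;
  -- the sum of the `K i` serves as a common constant.
  have hline : ∀ a ∈ Set.Icc (0 : ℝ) 1, ∀ i, AffineMap.lineMap y z a ∈ t i := fun a ha i =>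
    Set.mem_iInter.1 (hball ((convex_ball x r).lineMap_mem hy hz ha)) i
  have key := dist_le_of_closed_cover (h := fun a : ℝ => g (AffineMap.lineMap y z a))
    (C := (∑ i, K i : ℝ≥0) * dist y z) (E := fun i => AffineMap.lineMap y z ⁻¹' E i)
    (fun i => (hE i).preimage AffineMap.lineMap_continuous) Finset.univ 0 zero_le_one
    (fun i _ a ha b hb => by
      simp only [heq i _ ha.1, heq i _ hb.1]
      refine ((hK i).dist_le_mul _ (hline a ha.2 i) _ (hline b hb.2 i)).trans ?_
      rw [dist_lineMap_lineMap, Real.dist_eq, mul_assoc, mul_comm (dist y z)]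
      gcongr
      exact Finset.single_le_sum (f := K) (fun _ _ => zero_le) (Finset.mem_univ i))
    (fun a _ => by simpa using hcov (AffineMap.lineMap y z a))
  simpa using key

end LocallyLipschitz

/-! ### Ranks in quotients -/

section FiniteDimensional

variable {k M : Type*} [Field k] [AddCommGroup M] [Module k M]

/-- Rank-nullity for the quotient map restricted to `Z`, whose kernel is `Z ⊓ B`. -/
theorem Submodule.finrank_map_mkQ_add_finrank_inf (Z B : Submodule k M) [FiniteDimensional k Z] :
    Module.finrank k (Z.map B.mkQ) + Module.finrank k (Z ⊓ B : Submodule k M) =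
      Module.finrank k Z := by
  have h := (B.mkQ.domRestrict Z).finrank_range_add_finrank_ker
  rw [LinearMap.range_domRestrict, LinearMap.ker_domRestrict, Submodule.ker_mkQ] at h
  rw [← h, ← Submodule.map_comap_subtype, Submodule.finrank_map_subtype_eq]

/-- The rank inequality behind the nonnegativity of persistence multiplicities. -/
theorem Submodule.finrank_map_mkQ_add_le {Z' Z B' B : Submodule k M} [FiniteDimensional k Z]
    (hZ : Z' ≤ Z) (hB : B' ≤ B) :
    Module.finrank k (Z.map B.mkQ) + Module.finrank k (Z'.map B'.mkQ) ≤
      Module.finrank k (Z.map B'.mkQ) + Module.finrank k (Z'.map B.mkQ) := by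
  have : FiniteDimensional k Z' := Submodule.finiteDimensional_of_le hZ
  have h1 := Submodule.finrank_map_mkQ_add_finrank_inf Z B
  have h2 := Submodule.finrank_map_mkQ_add_finrank_inf Z B'
  have h3 := Submodule.finrank_map_mkQ_add_finrank_inf Z' B
  have h4 := Submodule.finrank_map_mkQ_add_finrank_inf Z' B'
  have : FiniteDimensional k (Z ⊓ B : Submodule k M) :=
    Submodule.finiteDimensional_of_le inf_le_left
  have : FiniteDimensional k (Z' ⊓ B : Submodule k M) :=
    Submodule.finiteDimensional_of_le inf_le_left
  have : FiniteDimensional k (Z ⊓ B' : Submodule k M) :=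
    Submodule.finiteDimensional_of_le inf_le_left
  -- By rank-nullity the claim compares dimensions of intersections: `Z' ⊓ B` and `Z ⊓ B'` both lie
  -- in `Z ⊓ B` and meet in `Z' ⊓ B'`.
  have h5 := Submodule.finrank_sup_add_finrank_inf_eq (Z' ⊓ B) (Z ⊓ B')
  have h6 : (Z' ⊓ B) ⊓ (Z ⊓ B') = Z' ⊓ B' := by
    apply le_antisymm
    · exact le_inf (inf_le_left.trans inf_le_left) (inf_le_right.trans inf_le_right)
    · exact le_inf (inf_le_inf_left _ hB) (inf_le_inf_right _ hZ)
  have h7 : Module.finrank k ((Z' ⊓ B) ⊔ (Z ⊓ B') : Submodule k M) ≤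
      Module.finrank k (Z ⊓ B : Submodule k M) :=
    Submodule.finrank_mono (sup_le (inf_le_inf_right _ hZ) (inf_le_inf_left _ hB))
  rw [h6] at h5
  omega

end FiniteDimensional

/-! ### Additivity of persistence multiplicities -/

section PersistenceMultiplicity

variable {V : Type*}

theorem simplicialChains_mono (p : ℕ) {K L : Set (Finset V)} (h : K ⊆ L) :
    simplicialChains p K ≤ simplicialChains p L :=
  Finsupp.supported_mono fun _ hσ => ⟨h hσ.1, hσ.2⟩

variable [DecidableEq V]

theorem relativeCycles_mono (p : ℕ) {P Q : Set (Finset V) × Set (Finset V)} (h : P ≤ Q) :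
    relativeCycles p P ≤ relativeCycles p Q :=
  inf_le_inf (simplicialChains_mono p h.1) (Submodule.comap_mono (Finsupp.supported_mono h.2))

theorem relativeBoundaries_mono (p : ℕ) {P Q : Set (Finset V) × Set (Finset V)} (h : P ≤ Q) :
    relativeBoundaries p P ≤ relativeBoundaries p Q :=
  sup_le_sup (Submodule.map_mono (simplicialChains_mono _ h.1)) (simplicialChains_mono p h.2)

theorem finiteDimensional_relativeCycles (p : ℕ) {P : Set (Finset V) × Set (Finset V)}
    (h : P.1.Finite) : FiniteDimensional (ZMod 2) (relativeCycles p P) := by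
  have hfin : Finite {σ | σ ∈ P.1 ∧ σ.card = p + 1} := (h.subset fun _ hσ => hσ.1).to_subtype
  have : FiniteDimensional (ZMod 2) (simplicialChains p P.1) :=
    (Finsupp.supportedEquivFinsupp {σ | σ ∈ P.1 ∧ σ.card = p + 1}).symm.finiteDimensional
  exact Submodule.finiteDimensional_of_le inf_le_left

/-- The rank inequality shows that the subtraction of natural numbers is not truncated. The
multiplicity is thus a genuine mixed second difference, which can be telescoped. -/
theorem cast_persistenceMultiplicity (p : ℕ) {P' P Q' Q : Set (Finset V) × Set (Finset V)}
    (hP : P' ≤ P) (hQ : Q' ≤ Q) (h : P.1.Finite) :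
    (persistenceMultiplicity p P' P Q' Q : ℤ) =
      persistentBetti p P Q' + persistentBetti p P' Q -
        (persistentBetti p P Q + persistentBetti p P' Q') := by
  have := finiteDimensional_relativeCycles p h
  have h1 := Submodule.finrank_map_mkQ_add_le (relativeCycles_mono p hP)
    (relativeBoundaries_mono p hQ)
  unfold persistenceMultiplicity
  rw [Nat.cast_sub (by exact h1)]
  push_cast
  ring

/-- Along a filtration, multiplicities are additive over blocks of consecutive stages. -/
theorem persistenceMultiplicity_eq_sum (p : ℕ) {P : ℕ → Set (Finset V) × Set (Finset V)}
    (hP : Monotone P) (hfin : ∀ i, (P i).1.Finite) {i' i j' j : ℕ} (hi : i' ≤ i) (hj : j' ≤ j) :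
    persistenceMultiplicity p (P i') (P i) (P j') (P j) =
      ∑ s ∈ Finset.Ico i' i, ∑ t ∈ Finset.Ico j' j,
        persistenceMultiplicity p (P s) (P (s + 1)) (P t) (P (t + 1)) := by
  have hcast : ∀ {i' i j' j : ℕ}, i' ≤ i → j' ≤ j →
      (persistenceMultiplicity p (P i') (P i) (P j') (P j) : ℤ) =
        persistentBetti p (P i) (P j') + persistentBetti p (P i') (P j) -
        (persistentBetti p (P i) (P j) + persistentBetti p (P i') (P j')) :=
    fun hi hj => cast_persistenceMultiplicity p (hP hi) (hP hj) (hfin _)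
  -- Telescope in the death index first, then in the birth index.
  have hinner : ∀ s, (∑ t ∈ Finset.Ico j' j,
      (persistenceMultiplicity p (P s) (P (s + 1)) (P t) (P (t + 1)) : ℤ)) =
        persistenceMultiplicity p (P s) (P (s + 1)) (P j') (P j) := by
    intro s
    induction j, hj using Nat.le_induction with
    | base => simp [hcast s.le_succ le_rfl]
    | succ j hj ih =>
      rw [Finset.sum_Ico_succ_top hj, ih, hcast s.le_succ hj, hcast s.le_succ j.le_succ,
        hcast s.le_succ (hj.trans j.le_succ)]
      ring
  zify
  simp only [hinner]
  clear hinner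
  induction i, hi using Nat.le_induction with
  | base => simp [hcast le_rfl hj]; ring
  | succ i hi ih =>
    rw [Finset.sum_Ico_succ_top hi, ← ih, hcast hi hj, hcast i.le_succ hj,
      hcast (hi.trans i.le_succ) hj]
    ring

end PersistenceMultiplicity

/-! ### Thresholds, regrouping of sums, and diagonal points -/

theorem Nat.exists_forall_lt_iff_lt_of_antitone {k : ℕ} {q : ℕ → Prop}
    (hq : ∀ i j, i ≤ j → j < k → q j → q i) : ∃ N ≤ k, ∀ j < k, (q j ↔ j < N) := by
  induction k with
  | zero => exact ⟨0, le_rfl, by simp⟩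
  | succ k ih =>
    by_cases h : q k
    · exact ⟨k + 1, le_rfl, fun j hj => ⟨fun _ => hj, fun _ => hq j k (by omega) (by omega) h⟩⟩
    · obtain ⟨N, hN, hNq⟩ := ih fun i j hij hj => hq i j hij (by omega)
      refine ⟨N, by omega, fun j hj => ?_⟩
      rcases Nat.lt_succ_iff_lt_or_eq.1 hj with hj | rfl
      · exact hNq j hj
      · exact ⟨fun h' => absurd h' h, fun h' => absurd h' (by omega)⟩

/-- Turns sums over pairs of filtration values into sums over pairs of steps, each step `s` being
grouped under its value `v s`. -/
theorem Finset.sum_sum_fiberwise {α β M : Type*} [DecidableEq β] [AddCommMonoid M] {A B : Finset α}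
    {T : Finset β} {v : α → β} (hA : ∀ s ∈ A, v s ∈ T) (hB : ∀ t ∈ B, v t ∈ T) (g : α → α → M) :
    ∑ a ∈ T, ∑ b ∈ T, ∑ s ∈ A with v s = a, ∑ t ∈ B with v t = b, g s t =
      ∑ s ∈ A, ∑ t ∈ B, g s t := by
  rw [← Finset.sum_fiberwise_of_maps_to hA]
  refine Finset.sum_congr rfl fun a _ => ?_
  rw [Finset.sum_comm]
  exact Finset.sum_congr rfl fun s _ => Finset.sum_fiberwise_of_maps_to hB _

/-- Discarding the diagonal points of a multiset, as an additive map. -/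
def offDiagonalHom : Multiset (ℝ × ℝ) →+ Multiset (ℝ × ℝ) where
  toFun M := M.filter (fun p => p.1 ≠ p.2)
  map_zero' := Multiset.filter_zero _
  map_add' := Multiset.filter_add _

theorem offDiagonalHom_apply (M : Multiset (ℝ × ℝ)) :
    offDiagonalHom M = M.filter (fun p => p.1 ≠ p.2) := rfl

theorem offDiagonalHom_replicate_of_eq (m : ℕ) {a b : ℝ} (h : a = b) :
    offDiagonalHom (Multiset.replicate m (a, b)) = 0 := by
  rw [offDiagonalHom_apply]
  refine Multiset.filter_eq_nil.2 fun p hp => ?_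
  rw [Multiset.eq_of_mem_replicate hp]
  exact not_not.2 h

theorem PersDiagram.ofMultiset_eq_iff {M N : Multiset (ℝ × ℝ)} :
    PersDiagram.ofMultiset M = PersDiagram.ofMultiset N ↔ offDiagonalHom M = offDiagonalHom N :=
  Subtype.ext_iff

theorem Multiset.replicate_sum {ι α : Type*} (I : Finset ι) (m : ι → ℕ) (a : α) :
    Multiset.replicate (∑ i ∈ I, m i) a = ∑ i ∈ I, Multiset.replicate (m i) a :=
  map_sum (Multiset.replicateAddMonoidHom a) m I

/-! ### The extended filtration refined one vertex at a time -/

namespace GraphComplex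

variable {V : Type*} (K : GraphComplex V) (k : ℕ) (e : ℕ → V)

/-- The extended filtration of a graph along an enumeration `e 0, …, e (k - 1)` of its vertices:
the vertices are first added one at a time in increasing order, then coned off one at a time in
decreasing order. -/
def enumStage (s : ℕ) : Set (Finset V) × Set (Finset V) :=
  ({σ | σ ∈ K.faces ∧ ∀ c ∈ σ, ∃ j < k, j < s ∧ e j = c},
    -- At `s = 2 * k - N` the vertices of index at least `N` are coned off; for `s ≤ k` there are
    -- none.
    {σ | σ ∈ K.faces ∧ ∀ c ∈ σ, ∃ j < k, 2 * k ≤ s + j ∧ e j = c})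

theorem enumStage_mono : Monotone (K.enumStage k e) := by
  intro s t hst
  constructor
  · rintro σ ⟨h, h'⟩
    refine ⟨h, fun c hc => ?_⟩
    obtain ⟨j, hj, hjs, hc⟩ := h' c hc
    exact ⟨j, hj, by omega, hc⟩
  · rintro σ ⟨h, h'⟩
    refine ⟨h, fun c hc => ?_⟩
    obtain ⟨j, hj, hjs, hc⟩ := h' c hc
    exact ⟨j, hj, by omega, hc⟩

/-- The multiplicity of a pair of steps of the filtration `enumStage`. -/
def enumMultiplicity [DecidableEq V] (p s t : ℕ) : ℕ :=
  persistenceMultiplicity p (K.enumStage k e s) (K.enumStage k e (s + 1)) (K.enumStage k e t)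
    (K.enumStage k e (t + 1))

/-- The pairs of steps of the filtration `enumStage`, with their multiplicities. -/
def enumPairs [DecidableEq V] : Multiset (ℕ × ℕ) :=
  ∑ p ∈ Finset.range 2,
    ((∑ s ∈ Finset.range k, ∑ t ∈ Finset.range k,
        if s < t then Multiset.replicate (K.enumMultiplicity k e p s t) (s, t) else 0) +
      (∑ s ∈ Finset.range k, ∑ t ∈ Finset.Ico k (2 * k),
        Multiset.replicate (K.enumMultiplicity k e p s t) (s, t)) +
      (∑ s ∈ Finset.Ico k (2 * k), ∑ t ∈ Finset.Ico k (2 * k),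
        if s < t then Multiset.replicate (K.enumMultiplicity k e p s t) (s, t) else 0))

/-- The index of the vertex which enters at a step of the filtration `enumStage`. -/
def enumIndex (k s : ℕ) : ℕ := if s < k then s else 2 * k - 1 - s

variable {K k e} {φ : Finset V → ℝ}

/-- The stages of the extended filtration of `φ` are stages of `enumStage`, and the steps between
two consecutive ones are those at which the vertices of the corresponding value enter. -/
theorem exists_stage_eq_enumStage
    (hcov : ∀ σ ∈ K.faces, ∀ c ∈ σ, ∃ j < k, e j = c)
    (hle : ∀ σ ∈ K.faces, ∀ a, φ σ ≤ a ↔ ∀ c ∈ σ, φ {c} ≤ a)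
    (hlt : ∀ σ ∈ K.faces, ∀ a, φ σ < a ↔ ∀ c ∈ σ, φ {c} < a)
    (hmono : ∀ i j, i ≤ j → j < k → φ {e i} ≤ φ {e j}) (a : ℝ) :
    ∃ N' N, N' ≤ N ∧ N ≤ k ∧
      K.ascStageBefore φ a = K.enumStage k e N' ∧ K.ascStage φ a = K.enumStage k e N ∧
      K.descStageBefore φ a = K.enumStage k e (2 * k - N) ∧
      K.descStage φ a = K.enumStage k e (2 * k - N') ∧
      Finset.Ico N' N = {s ∈ Finset.range k | φ {e (enumIndex k s)} = a} ∧
      Finset.Ico (2 * k - N) (2 * k - N') =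
        {s ∈ Finset.Ico k (2 * k) | φ {e (enumIndex k s)} = a} := by
  -- `N` and `N'` count the vertices of value at most `a` and less than `a`; those of value exactly
  -- `a` are the block from `N'` to `N`.
  obtain ⟨N, hNk, hN⟩ := Nat.exists_forall_lt_iff_lt_of_antitone (k := k)
    (q := fun j => φ {e j} ≤ a) fun i j hij hj h => (hmono i j hij hj).trans h
  obtain ⟨N', hNk', hN'⟩ := Nat.exists_forall_lt_iff_lt_of_antitone (k := k)
    (q := fun j => φ {e j} < a) fun i j hij hj h => (hmono i j hij hj).trans_lt h
  have hNN : N' ≤ N := by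
    by_contra! h
    exact absurd ((hN N (by omega)).1 ((hN' N (by omega)).2 h).le) (lt_irrefl N)
  have heq : ∀ j < k, (φ {e j} = a ↔ N' ≤ j ∧ j < N) := fun j hj => by
    rw [le_antisymm_iff, hN j hj, ← not_lt, hN' j hj]
    omega
  have hempty : ∀ s ≤ k, (K.enumStage k e s).2 = ∅ := by
    refine fun s hs => Set.eq_empty_iff_forall_notMem.2 ?_
    rintro σ ⟨h, h'⟩
    obtain ⟨c, hc⟩ := (K.isRelLowerSet_faces h).1
    obtain ⟨j, hj, hjs, -⟩ := h' c hc
    omega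
  have hfull : ∀ s, k ≤ s → (K.enumStage k e s).1 = K.faces := by
    refine fun s hs => Set.Subset.antisymm (fun σ h => h.1) fun σ h => ⟨h, fun c hc => ?_⟩
    obtain ⟨j, hj, hjc⟩ := hcov σ h c hc
    exact ⟨j, hj, by omega, hjc⟩
  have hext : ∀ {q r : V → Prop} {Q : ℕ → Prop}, (∀ c, r c ↔ q c) →
      (∀ j < k, (q (e j) ↔ Q j)) → ∀ σ ∈ K.faces,
        ((∀ c ∈ σ, r c) ↔ ∀ c ∈ σ, ∃ j < k, Q j ∧ e j = c) := by
    intro q r Q hrq hqQ σ hσ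
    refine forall₂_congr fun c hc => ?_
    rw [hrq]
    constructor
    · intro h
      obtain ⟨j, hj, rfl⟩ := hcov σ hσ c hc
      exact ⟨j, hj, (hqQ j hj).1 h, rfl⟩
    · rintro ⟨j, hj, hQ, rfl⟩
      exact (hqQ j hj).2 hQ
  refine ⟨N', N, hNN, hNk, ?_, ?_, ?_, ?_, ?_, ?_⟩
  · refine Prod.ext ?_ (hempty N' hNk').symm
    ext σ
    refine and_congr_right fun hσ => (hlt σ hσ a).trans ?_
    exact hext (q := fun c => φ {c} < a) (fun _ => Iff.rfl) hN' σ hσ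
  · refine Prod.ext ?_ (hempty N hNk).symm
    ext σ
    refine and_congr_right fun hσ => (hle σ hσ a).trans ?_
    exact hext (q := fun c => φ {c} ≤ a) (fun _ => Iff.rfl) hN σ hσ
  · refine Prod.ext (hfull _ (by omega)).symm ?_
    ext σ
    refine and_congr_right fun hσ => ?_
    refine hext (q := fun c => ¬ φ {c} ≤ a) (fun _ => not_le.symm) (fun j hj => ?_) σ hσ
    rw [hN j hj]
    omega
  · refine Prod.ext (hfull _ (by omega)).symm ?_
    ext σ
    refine and_congr_right fun hσ => ?_
    refine hext (q := fun c => ¬ φ {c} < a) (fun _ => not_lt.symm) (fun j hj => ?_) σ hσ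
    rw [hN' j hj]
    omega
  · ext s
    simp only [Finset.mem_Ico, Finset.mem_filter, Finset.mem_range]
    constructor
    · intro h
      have hs : s < k := by omega
      simpa [enumIndex, hs, heq s hs] using h
    · rintro ⟨hs, h⟩
      simpa [enumIndex, hs, heq s hs] using h
  · ext s
    simp only [Finset.mem_Ico, Finset.mem_filter]
    constructor
    · intro h
      refine ⟨by omega, ?_⟩
      -- In the descending half, the step from `s` to `s + 1` cones off the vertex of index `2 * k -
      -- 1 - s`, so blocks are reversed.
      rw [enumIndex, if_neg (by omega), heq _ (by omega)]
      omega
    · rintro ⟨hs, h⟩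
      rw [enumIndex, if_neg (by omega), heq _ (by omega)] at h
      omega

/-- For filtrations whose order on the vertices is compatible with a fixed enumeration, the points
of the extended diagram are given by fixed pairs of vertices. -/
theorem extendedDiagram_eq_map_enumPairs [DecidableEq V]
    (hvert : ∀ j < k, {e j} ∈ K.faces)
    (hcov : ∀ σ ∈ K.faces, ∀ c ∈ σ, ∃ j < k, e j = c)
    (hle : ∀ σ ∈ K.faces, ∀ a, φ σ ≤ a ↔ ∀ c ∈ σ, φ {c} ≤ a)
    (hlt : ∀ σ ∈ K.faces, ∀ a, φ σ < a ↔ ∀ c ∈ σ, φ {c} < a)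
    (hmono : ∀ i j, i ≤ j → j < k → φ {e i} ≤ φ {e j}) :
    K.extendedDiagram φ = PersDiagram.ofMultiset ((K.enumPairs k e).map
      fun q => (φ {e (enumIndex k q.1)}, φ {e (enumIndex k q.2)})) := by
  set v : ℕ → ℝ := fun s => φ {e (enumIndex k s)} with hv
  have hvals : ∀ s < 2 * k, v s ∈ K.filtrationValues φ := fun s hs =>
    Finset.mem_image_of_mem φ (K.finite_faces.mem_toFinset.2 (hvert _ (by
      unfold enumIndex; split_ifs <;> omega)))
  have hA : ∀ s ∈ Finset.range k, v s ∈ K.filtrationValues φ := fun s hs =>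
    hvals s (by have := Finset.mem_range.1 hs; omega)
  have hD : ∀ s ∈ Finset.Ico k (2 * k), v s ∈ K.filtrationValues φ := fun s hs =>
    hvals s (Finset.mem_Ico.1 hs).2
  choose N' N hNN hNk hab ha hdb hd hfa hfd using
    exists_stage_eq_enumStage hcov hle hlt hmono
  have hfin : ∀ i, (K.enumStage k e i).1.Finite := fun i => K.finite_faces.subset fun _ h => h.1
  have hsum := fun p {i' i j' j : ℕ} (hi : i' ≤ i) (hj : j' ≤ j) =>
    persistenceMultiplicity_eq_sum p (K.enumStage_mono k e) hfin hi hj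
  have hblock : ∀ (p : ℕ) (A B : Finset ℕ) (a b : ℝ),
      Multiset.replicate (∑ s ∈ A with v s = a, ∑ t ∈ B with v t = b,
        K.enumMultiplicity k e p s t) (a, b) =
      ∑ s ∈ A with v s = a, ∑ t ∈ B with v t = b,
        Multiset.replicate (K.enumMultiplicity k e p s t) (v s, v t) := by
    intro p A B a b
    simp only [Multiset.replicate_sum]
    refine Finset.sum_congr rfl fun s hs => Finset.sum_congr rfl fun t ht => ?_
    rw [(Finset.mem_filter.1 hs).2, (Finset.mem_filter.1 ht).2]
  have hif : ∀ (p : ℕ) (A B : Finset ℕ) (R : ℝ → ℝ → Prop) [∀ a b, Decidable (R a b)] (a b : ℝ),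
      (if R a b then Multiset.replicate (∑ s ∈ A with v s = a, ∑ t ∈ B with v t = b,
        K.enumMultiplicity k e p s t) (a, b) else 0) =
      ∑ s ∈ A with v s = a, ∑ t ∈ B with v t = b,
        if R (v s) (v t) then Multiset.replicate (K.enumMultiplicity k e p s t) (v s, v t)
        else 0 := by
    intro p A B R _ a b
    rw [hblock]
    by_cases h : R a b
    · rw [if_pos h]
      refine Finset.sum_congr rfl fun s hs => Finset.sum_congr rfl fun t ht => ?_
      rw [(Finset.mem_filter.1 hs).2, (Finset.mem_filter.1 ht).2, if_pos h]
    · rw [if_neg h]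
      refine (Finset.sum_eq_zero fun s hs => Finset.sum_eq_zero fun t ht => ?_).symm
      rw [(Finset.mem_filter.1 hs).2, (Finset.mem_filter.1 ht).2, if_neg h]
  -- The multiplicity of a pair of values is the sum over the two blocks of steps carrying those
  -- values.
  have h1 : ∀ p a b, persistenceMultiplicity p (K.ascStageBefore φ a) (K.ascStage φ a)
      (K.ascStageBefore φ b) (K.ascStage φ b) = ∑ s ∈ Finset.range k with v s = a,
        ∑ t ∈ Finset.range k with v t = b, K.enumMultiplicity k e p s t := fun p a b => by
    rw [hab, ha, hab, ha, hsum p (hNN a) (hNN b), hfa, hfa]; rfl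
  have h2 : ∀ p a b, persistenceMultiplicity p (K.ascStageBefore φ a) (K.ascStage φ a)
      (K.descStageBefore φ b) (K.descStage φ b) = ∑ s ∈ Finset.range k with v s = a,
        ∑ t ∈ Finset.Ico k (2 * k) with v t = b, K.enumMultiplicity k e p s t := fun p a b => by
    rw [hab, ha, hdb, hd, hsum p (hNN a) (Nat.sub_le_sub_left (hNN b) _), hfa, hfd]; rfl
  have h3 : ∀ p a b, persistenceMultiplicity p (K.descStageBefore φ a) (K.descStage φ a)
      (K.descStageBefore φ b) (K.descStage φ b) = ∑ s ∈ Finset.Ico k (2 * k) with v s = a,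
        ∑ t ∈ Finset.Ico k (2 * k) with v t = b, K.enumMultiplicity k e p s t := fun p a b => by
    rw [hdb, hd, hdb, hd, hsum p (Nat.sub_le_sub_left (hNN a) _) (Nat.sub_le_sub_left (hNN b) _),
      hfd, hfd]; rfl
  have hinc : ∀ s < k, ∀ t < k, s ≤ t → v s ≤ v t := fun s hs t ht hst => by
    simpa [hv, enumIndex, hs, ht] using hmono s t hst ht
  have hdec : ∀ s, k ≤ s → ∀ t, k ≤ t → t < 2 * k → s ≤ t → v t ≤ v s := fun s hs t ht htk hst => by
    simpa [hv, enumIndex, hs.not_gt, ht.not_gt] using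
      hmono (2 * k - 1 - t) (2 * k - 1 - s) (by omega) (by omega)
  unfold extendedDiagram enumPairs
  rw [PersDiagram.ofMultiset_eq_iff]
  have hlt' := fun p A B => hif p A B (fun a b => a < b)
  have hgt' := fun p A B => hif p A B (fun a b => b < a)
  simp only [h1, h2, h3, hlt', hgt']
  simp only [hblock,
    Finset.sum_add_distrib, Finset.sum_sum_fiberwise hA hA, Finset.sum_sum_fiberwise hA hD,
    Finset.sum_sum_fiberwise hD hD, ← Multiset.coe_mapAddMonoidHom, map_sum, map_add]
  simp only [Multiset.coe_mapAddMonoidHom, apply_ite (Multiset.map _), Multiset.map_replicate,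
    Multiset.map_zero]
  -- The middle families agree. In the other two, `s < t` and the strict comparison of values
  -- disagree only when the values are equal, and such pairs give diagonal points.
  congr 1
  · congr 1
    refine Finset.sum_congr rfl fun p _ => Finset.sum_congr rfl fun s hs =>
      Finset.sum_congr rfl fun t ht => ?_
    rw [Finset.mem_range] at hs ht
    by_cases hst : s < t
    · rw [if_pos hst]
      rcases (hinc s hs t ht hst.le).lt_or_eq with h | h
      · rw [if_pos h]
      · rw [if_neg h.not_lt, map_zero]
        exact (offDiagonalHom_replicate_of_eq _ h).symm
    · rw [if_neg hst, if_neg (hinc t ht s hs (not_lt.1 hst)).not_gt]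
  · refine Finset.sum_congr rfl fun p _ => Finset.sum_congr rfl fun s hs =>
      Finset.sum_congr rfl fun t ht => ?_
    rw [Finset.mem_Ico] at hs ht
    by_cases hst : s < t
    · rw [if_pos hst]
      rcases (hdec s hs.1 t ht.1 ht.2 hst.le).lt_or_eq with h | h
      · rw [if_pos h]
      · rw [if_neg h.not_lt, map_zero]
        exact (offDiagonalHom_replicate_of_eq _ h.symm).symm
    · rw [if_neg hst, if_neg (hdec t ht.1 s hs.1 hs.2 (not_lt.1 hst)).not_gt]

end GraphComplex

/-- The length of a fixed list of labels fixes the size at which `ℓ` is evaluated, however many of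
the points fall on the diagonal. -/
theorem PersDiagram.ofMultiset_map_eq_ofCoords {α : Type*} (L : List α) (g : α → ℝ × ℝ) :
    PersDiagram.ofMultiset ((L : Multiset α).map g) =
      PersDiagram.ofCoords L.length (fun i =>
        if (finProdFinEquiv.symm i).2 = 0 then (g (L.get (finProdFinEquiv.symm i).1)).1
        else (g (L.get (finProdFinEquiv.symm i).1)).2) := by
  unfold PersDiagram.ofCoords
  congr 1
  rw [Multiset.map_coe]
  simp only [Equiv.symm_apply_apply, if_true, one_ne_zero, if_false, Prod.mk.eta, Fin.univ_val_map]
  congr 1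
  refine List.ext_getElem (by simp) fun i h1 h2 => ?_
  simp

/-! ### Cluster means and the loss of a fixed Mapper graph -/

section Mapper

variable {X : Type*}

theorem mapperFiltration_singleton (F : X → ℝ) (c : Finset X) :
    mapperFiltration F {c} = clusterMean F c := by simp [mapperFiltration]

theorem mapperFiltration_le_iff (F : X → ℝ) {σ : Finset (Finset X)} (hσ : σ.Nonempty) (a : ℝ) :
    mapperFiltration F σ ≤ a ↔ ∀ c ∈ σ, clusterMean F c ≤ a := by
  unfold mapperFiltration
  rw [csSup_le_iff ((σ.finite_toSet.image _).bddAbove) (hσ.to_set.image _)]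
  simp

theorem mapperFiltration_lt_iff (F : X → ℝ) {σ : Finset (Finset X)} (hσ : σ.Nonempty) (a : ℝ) :
    mapperFiltration F σ < a ↔ ∀ c ∈ σ, clusterMean F c < a := by
  unfold mapperFiltration
  rw [(σ.finite_toSet.image _).csSup_lt_iff (hσ.to_set.image _)]
  simp

/-- An enumeration of a finite set of finite sets, extended by the empty set. -/
def extendEnum {k : ℕ} {C : Finset (Finset X)} (π : Fin k ≃ C) (j : ℕ) : Finset X :=
  if h : j < k then (π ⟨j, h⟩ : Finset X) else ∅

theorem extendEnum_mem {k : ℕ} {C : Finset (Finset X)} (π : Fin k ≃ C) {j : ℕ} (hj : j < k) :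
    extendEnum π j ∈ C := by
  rw [extendEnum, dif_pos hj]
  exact (π ⟨j, hj⟩).2

variable [DecidableEq X] {n r : ℕ}

/-- Clusters contain only cloud points, where `f` is controlled. -/
theorem subset_image_of_mem_pullbackCover {Clus : ClusteringAlgorithm X} {x : Fin n → X}
    {e : CoverAssignment n r} {c : Finset X} (hc : c ∈ pullbackCover Clus x e) :
    c ⊆ Finset.univ.image x := by
  obtain ⟨j, -, hj⟩ := Finset.mem_biUnion.1 hc
  exact ((Clus _).le hj).trans (Finset.image_subset_image (Finset.filter_subset _ _))

theorem singleton_mem_mapComp {Clus : ClusteringAlgorithm X} {x : Fin n → X}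
    {e : CoverAssignment n r} {c : Finset X} (hc : c ∈ pullbackCover Clus x e) :
    {c} ∈ (mapComp Clus x e).faces :=
  ⟨Finset.singleton_nonempty c, Finset.singleton_subset_iff.2 hc, by simp, fun a ha b hb hab =>
    absurd ((Finset.mem_singleton.1 ha).trans (Finset.mem_singleton.1 hb).symm) hab⟩

variable {s : ℕ} {S : OMinimalStructure} {x : Fin n → X} {f : (Fin s → ℝ) → X → ℝ}

theorem definableFun_clusterMean (hf : ∀ i, S.DefinableFun (fun θ => f θ (x i))) {c : Finset X}
    (hc : c ⊆ Finset.univ.image x) : S.DefinableFun (fun θ => clusterMean (f θ) c) := by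
  unfold clusterMean
  simp only [div_eq_mul_inv]
  refine (OMinimalStructure.DefinableFun.sum c fun y hy => ?_).mul
    (OMinimalStructure.definableFun_const _)
  obtain ⟨i, -, rfl⟩ := Finset.mem_image.1 (hc hy)
  exact hf i

theorem locallyLipschitz_clusterMean (hf : ∀ i, LocallyLipschitz (fun θ => f θ (x i)))
    {c : Finset X} (hc : c ⊆ Finset.univ.image x) :
    LocallyLipschitz (fun θ => clusterMean (f θ) c) := by
  unfold clusterMean
  simp only [div_eq_mul_inv]
  refine (LocallyLipschitz.sum_real c fun y hy => ?_).mul_real (LocallyLipschitz.const _)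
  obtain ⟨i, -, rfl⟩ := Finset.mem_image.1 (hc hy)
  exact hf i

/-- The default value `∅` is harmless here, so no bound on `j` has to be carried. -/
theorem extendEnum_subset {Clus : ClusteringAlgorithm X} {e : CoverAssignment n r} {k : ℕ}
    (π : Fin k ≃ pullbackCover Clus x e) (j : ℕ) : extendEnum π j ⊆ Finset.univ.image x := by
  by_cases h : j < k
  · exact subset_image_of_mem_pullbackCover (extendEnum_mem π h)
  · simp [extendEnum, h]

/-- A maximum over vertices is at most `a`, or less than `a`, exactly when every vertex value is, so
the filtration is governed by its vertices. -/
theorem mapPers_eq_of_monotone {Clus : ClusteringAlgorithm X} {e : CoverAssignment n r} {k : ℕ}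
    (π : Fin k ≃ pullbackCover Clus x e) {F : X → ℝ}
    (hπ : Monotone fun i => clusterMean F (π i)) :
    mapPers (mapComp Clus x e) F =
      PersDiagram.ofMultiset (((mapComp Clus x e).enumPairs k (extendEnum π)).map fun q =>
        (clusterMean F (extendEnum π (GraphComplex.enumIndex k q.1)),
          clusterMean F (extendEnum π (GraphComplex.enumIndex k q.2)))) := by
  have h := GraphComplex.extendedDiagram_eq_map_enumPairs (K := mapComp Clus x e) (k := k)
    (e := extendEnum π) (φ := mapperFiltration F)
    (fun j hj => singleton_mem_mapComp (extendEnum_mem π hj))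
    (fun σ hσ c hc => ⟨π.symm ⟨c, hσ.2.1 hc⟩, (π.symm _).2, by simp [extendEnum]⟩)
    (fun σ hσ a => by
      simpa only [mapperFiltration_singleton] using mapperFiltration_le_iff F hσ.1 a)
    (fun σ hσ a => by
      simpa only [mapperFiltration_singleton] using mapperFiltration_lt_iff F hσ.1 a)
    (fun i j hij hj => by
      simpa only [mapperFiltration_singleton, extendEnum, dif_pos hj, dif_pos (hij.trans_lt hj)]
        using @hπ ⟨i, hij.trans_lt hj⟩ ⟨j, hj⟩ hij)
  simp only [mapperFiltration_singleton] at h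
  exact h

/-- The loss of a fixed Mapper complex is definable and locally Lipschitz in the parameter of the
filter function. -/
theorem definableFun_and_locallyLipschitz_mapperLoss (Clus : ClusteringAlgorithm X)
    {ℓ : PersDiagram → ℝ}
    (hf : ∀ i : Fin n,
      S.DefinableFun (fun θ => f θ (x i)) ∧ LocallyLipschitz (fun θ => f θ (x i)))
    (hℓ : ∀ m : ℕ,
      S.DefinableFun (fun v => ℓ (PersDiagram.ofCoords m v)) ∧
        LocallyLipschitz (fun v => ℓ (PersDiagram.ofCoords m v)))
    (e : CoverAssignment n r) :
    S.DefinableFun (fun θ => mapperLoss Clus x ℓ e (f θ)) ∧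
      LocallyLipschitz (fun θ => mapperLoss Clus x ℓ e (f θ)) := by
  set C := pullbackCover Clus x e
  set k := C.card
  have hdef : ∀ c ⊆ Finset.univ.image x, S.DefinableFun (fun θ => clusterMean (f θ) c) :=
    fun c hc => definableFun_clusterMean (fun i => (hf i).1) hc
  have hlip : ∀ c ⊆ Finset.univ.image x, LocallyLipschitz (fun θ => clusterMean (f θ) c) :=
    fun c hc => locallyLipschitz_clusterMean (fun i => (hf i).2) hc
  have hsub : ∀ (π : Fin k ≃ C) i, (π i : Finset X) ⊆ Finset.univ.image x :=
    fun π i => subset_image_of_mem_pullbackCover (π i).2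
  let E : (Fin k ≃ C) → Set (Fin s → ℝ) := fun π =>
    ⋂ p : {p : Fin k × Fin k // p.1 ≤ p.2},
      {θ | clusterMean (f θ) (π p.1.1) ≤ clusterMean (f θ) (π p.1.2)}
  have hmono : ∀ π, ∀ θ, θ ∈ E π ↔ Monotone fun i => clusterMean (f θ) (π i) := by
    intro π θ
    simp only [E, Set.mem_iInter]
    exact ⟨fun h i j hij => h ⟨(i, j), hij⟩, fun h p => h p.2⟩
  -- Sorting the cluster means at `θ` produces the ordering.
  have hcov : ∀ θ, ∃ π, θ ∈ E π := fun θ =>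
    ⟨(Tuple.sort fun i => clusterMean (f θ) (C.equivFin.symm i)).trans C.equivFin.symm,
      (hmono _ _).2 (Tuple.monotone_sort fun i => clusterMean (f θ) (C.equivFin.symm i))⟩
  -- These pairs depend on `π` but not on `θ`, so `w` gives coordinates defined on all of the
  -- parameter space.
  let L : (Fin k ≃ C) → List (ℕ × ℕ) := fun π =>
    ((mapComp Clus x e).enumPairs k (extendEnum π)).toList
  let w : ∀ π : Fin k ≃ C, Fin ((L π).length * 2) → (Fin s → ℝ) → ℝ := fun π i θ =>
    clusterMean (f θ) (extendEnum π (GraphComplex.enumIndex k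
      (if (finProdFinEquiv.symm i).2 = 0 then ((L π).get (finProdFinEquiv.symm i).1).1
        else ((L π).get (finProdFinEquiv.symm i).1).2)))
  have heq : ∀ π, ∀ θ ∈ E π, mapperLoss Clus x ℓ e (f θ) =
      ℓ (PersDiagram.ofCoords (L π).length (fun i => w π i θ)) := by
    intro π θ hθ
    unfold mapperLoss
    rw [mapPers_eq_of_monotone π ((hmono π θ).1 hθ), ← Multiset.coe_toList
      ((mapComp Clus x e).enumPairs k (extendEnum π)), PersDiagram.ofMultiset_map_eq_ofCoords]
    congr 2
    funext i
    simp only [w]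
    split_ifs <;> rfl
  constructor
  · exact OMinimalStructure.definableFun_of_cover
      (fun π => S.iInter_mem _ fun p => (hdef _ (hsub π _)).setOf_le_mem (hdef _ (hsub π _)))
      (fun π => (hℓ (L π).length).1.comp fun i => hdef _ (extendEnum_subset π _)) hcov heq
  · exact locallyLipschitz_of_closed_cover
      (fun π => isClosed_iInter fun p => isClosed_le (hlip _ (hsub π _)).continuous
        (hlip _ (hsub π _)).continuous)
      (fun π => (hℓ (L π).length).2.comp
        (LocallyLipschitz.pi fun i => hlip _ (extendEnum_subset π _))) hcov heq

end Mapper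

end

/-! ### The risk as a finite sum of products -/

theorem theorem1 {s n r : ℕ} {X : Type*} [MetricSpace X] [DecidableEq X]
    (x : Fin n → X) (Clus : ClusteringAlgorithm X)
    (S : OMinimalStructure)
    (f : (Fin s → ℝ) → X → ℝ)
    (ℓ : PersDiagram → ℝ)
    {Ω : Type*} [MeasurableSpace Ω] (Pr : (Fin s → ℝ) → Measure Ω)
    [∀ θ, IsProbabilityMeasure (Pr θ)]
    (A : Ω → CoverAssignment n r) (hA : Measurable A)
    (hf : ∀ i : Fin n,
      S.DefinableFun (fun θ => f θ (x i)) ∧ LocallyLipschitz (fun θ => f θ (x i)))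
    (hℓ : ∀ m : ℕ,
      S.DefinableFun (fun v => ℓ (PersDiagram.ofCoords m v)) ∧
        LocallyLipschitz (fun v => ℓ (PersDiagram.ofCoords m v)))
    (hP : ∀ e : CoverAssignment n r,
      S.DefinableFun (fun θ => (Pr θ).real {ω | A ω = e}) ∧
        LocallyLipschitz (fun θ => (Pr θ).real {ω | A ω = e})) :
    S.DefinableFun (softMapperRisk Clus x ℓ f Pr A) ∧
      LocallyLipschitz (softMapperRisk Clus x ℓ f Pr A) := by
  have hL := fun e : CoverAssignment n r =>
    definableFun_and_locallyLipschitz_mapperLoss Clus hf hℓ e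
  rw [funext (softMapperRisk_eq_sum Clus x ℓ f Pr A hA)]
  exact ⟨.sum _ fun e _ => (hL e).1.mul (hP e).1,
    .sum_real _ fun e _ => (hL e).2.mul_real (hP e).2⟩
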